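/- Let $0\le k\le n$. Consider a two-party quantum protocol with $m$ rounds: Alice and Bob have finite-dimensional private spaces $\mathcal A$, $\mathcal B$ and share a finite-dimensional message space $\mathcal M$, each initialised in a fixed basis state $|0\rangle$. In round $j$ Alice applies a unitary $U_{A,j}$ to $\mathcal A\otimes\mathcal M$ and then Bob applies a unitary $U_{B,j}$ to $\mathcal M\otimes\mathcal B$; let $|\psi\rangle$ be the final state of an honest run. Finally Alice measures $\mathcal A$ with a POVM $\{\Pi_{A,\mathrm{abort}}\}\cup\{\Pi_{A,x}: x\in\mathbb Z_2^n\}$ and Bob measures $\mathcal B$ with a POVM $\{\Pi_{B,\mathrm{abort}}\}\cup\{\Pi_{B,(b,x_b)}\}$, where $b$ ranges over the $k$-element subsets of $\{1,\dots,n\}$ and $x_b\in\mathbb Z_2^b$. Call $x$ and $(b,x_b)$ consistent if $x_b=(x_i)_{i\in b}$. The protocol is a $k$-out-of-$n$ forcing oblivious transfer protocol if $$\Pr[\text{Alice honestly outputs } x \text{ and Bob honestly outputs } (b,x_b)]=\langle\psi|\Pi_{A,x}\otimes I_{\mathcal M}\otimes\Pi_{B,(b,x_b)}|\psi\rangle=\frac{1}{\binom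 nk 2^n}$$ for all consistent $x,(b,x_b)$. Let $B_x$ be the supremum, over all strategies of Bob (an arbitrary finite-dimensional private space, initialised in a basis state, and arbitrary unitaries on it and $\mathcal M$ in his turns), of the probability that honest Alice outputs $x$. Let $A_{b,x_b}$ be the supremum, over all strategies of Alice defined likewise, of the probability that honest Bob outputs $(b,x_b)$. Define $\varepsilon_A(b,x_b)$ and $\varepsilon_B(x)$ by $A_{b,x_b}=\varepsilon_A(b,x_b)/\bigl(\binom nk 2^k\bigr)$ and $B_x=\varepsilon_B(x)/2^n$, and let the forcing bias be $\varepsilon=\max\{\max_{b,x_b}\varepsilon_A(b,x_b),\max_x\varepsilon_B(x)\}$. Theorem. In any $k$-out-of-$n$ forcing oblivious transfer protocol and for all consistent $x,(b,x_b)$, $$B_x\cdot A_{b,x_b}\ \ge\ \Pr[\text{Alice honestly outputs } x \text{ and Bob honestly outputs } (b,x_b)]=\frac{1}{\binom nk 2^n},$$ and $\max\{\varepsilon_A(b,x_b),\varepsilon_B(x)\}\ge\sqrt2^{\,k}$. In particular, the forcing bias satisfies $\varepsilon\ge\sqrt2^{\,k}$. -/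

import Mathlib

namespace ForcingOT

open Matrix
open scoped Kronecker ComplexOrder

/-- Bob's outputs `(b, x_b)`: a `k`-element set `b` of indices together with a bit for each index
in `b`. -/
abbrev BobOutcome (n k : ℕ) : Type :=
  Σ b : {b : Finset (Fin n) // b.card = k}, (b.1 → ZMod 2)

/-- `x` and `(b, x_b)` are consistent: `x_b` is the restriction of `x` to `b`. -/
def Consistent {n k : ℕ} (x : Fin n → ZMod 2) (o : BobOutcome n k) : Prop :=
  ∀ i : o.1.1, o.2 i = x i

/-- A measurement (POVM) on the space `ℂ^ι` with outcomes in `ω`. -/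
structure POVM (ω ι : Type) [Fintype ω] [Fintype ι] [DecidableEq ι] where
  effect : ω → Matrix ι ι ℂ
  posSemidef : ∀ w, (effect w).PosSemidef
  sum_eq_one : ∑ w, effect w = 1

/-- Born rule: `⟨ψ| E |ψ⟩`. -/
noncomputable def born {ι : Type} [Fintype ι] (E : Matrix ι ι ℂ) (ψ : ι → ℂ) : ℝ :=
  (star ψ ⬝ᵥ (E *ᵥ ψ)).re

section Run

variable {α μ β : Type} [Fintype α] [DecidableEq α] [Fintype μ] [DecidableEq μ]
  [Fintype β] [DecidableEq β]

/-- `U ⊗ I` on `(𝒜 ⊗ ℳ) ⊗ ℬ`, regarded as an operator on `𝒜 ⊗ ℳ ⊗ ℬ`. -/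
def onLeft (β : Type) [DecidableEq β] (U : Matrix (α × μ) (α × μ) ℂ) :
    Matrix (α × μ × β) (α × μ × β) ℂ :=
  Matrix.reindex (Equiv.prodAssoc α μ β) (Equiv.prodAssoc α μ β) (U ⊗ₖ (1 : Matrix β β ℂ))

/-- `I ⊗ V` on `𝒜 ⊗ (ℳ ⊗ ℬ)`. -/
def onRight (α : Type) [DecidableEq α] (V : Matrix (μ × β) (μ × β) ℂ) :
    Matrix (α × μ × β) (α × μ × β) ℂ :=
  (1 : Matrix α α ℂ) ⊗ₖ V

/-- The joint state after `m` rounds. All three registers start in the basis state `|0⟩`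
(labelled by `a₀`, `m₀`, `b₀`); in round `j` the left player applies `U j` to her private register
and the message register, and then the right player applies `V j` to the message register and his
private register. -/
def finalState {m : ℕ} (a₀ : α) (m₀ : μ) (b₀ : β)
    (U : Fin m → unitaryGroup (α × μ) ℂ) (V : Fin m → unitaryGroup (μ × β) ℂ) :
    α × μ × β → ℂ :=
  Fin.foldl m
    (fun ψ j => onRight α (V j : Matrix (μ × β) (μ × β) ℂ) *ᵥ
      (onLeft β (U j : Matrix (α × μ) (α × μ) ℂ) *ᵥ ψ))
    (Pi.single (a₀, m₀, b₀) 1)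

end Run

/-- The data of an `m`-round two-party quantum protocol in which Alice outputs `x ∈ ℤ₂ⁿ` or aborts
and Bob outputs `(b, x_b)` or aborts. The spaces `𝒜`, `ℳ`, `ℬ` have orthonormal bases labelled by
`α`, `μ`, `β`; the outcome `none` is "abort". -/
structure Protocol (n k m : ℕ) (α μ β : Type) [Fintype α] [DecidableEq α] [Fintype μ]
    [DecidableEq μ] [Fintype β] [DecidableEq β] where
  a₀ : α
  m₀ : μ
  b₀ : β
  UA : Fin m → unitaryGroup (α × μ) ℂ
  UB : Fin m → unitaryGroup (μ × β) ℂ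
  measA : POVM (Option (Fin n → ZMod 2)) α
  measB : POVM (Option (BobOutcome n k)) β

namespace Protocol

variable {n k m : ℕ} {α μ β : Type} [Fintype α] [DecidableEq α] [Fintype μ] [DecidableEq μ]
  [Fintype β] [DecidableEq β]

/-- The probability that, in an honest run, Alice outputs `x` and Bob outputs `o = (b, x_b)`. -/
noncomputable def honestProb (P : Protocol n k m α μ β) (x : Fin n → ZMod 2)
    (o : BobOutcome n k) : ℝ :=
  born (P.measA.effect (some x) ⊗ₖ ((1 : Matrix μ μ ℂ) ⊗ₖ P.measB.effect (some o)))
    (finalState P.a₀ P.m₀ P.b₀ P.UA P.UB)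

/-- The protocol is a `k`-out-of-`n` forcing oblivious transfer protocol: in an honest run every
consistent pair of outputs occurs with the same probability `1 / (C(n,k) 2ⁿ)`. (There are
`C(n,k) 2ⁿ` such pairs, so inconsistent outputs and aborts have probability `0`.) -/
def IsForcingOT (P : Protocol n k m α μ β) : Prop :=
  ∀ (x : Fin n → ZMod 2) (o : BobOutcome n k), Consistent x o →
    P.honestProb x o = 1 / ((n.choose k : ℝ) * 2 ^ n)

/-- The probability that honest Alice outputs `x` against a Bob who uses a private register with
basis `γ`, initially in the state `|c₀⟩`, and applies the unitaries `V 1, …, V m` in his turns. -/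
noncomputable def probAliceOutputs (P : Protocol n k m α μ β) (x : Fin n → ZMod 2)
    {γ : Type} [Fintype γ] [DecidableEq γ] (c₀ : γ) (V : Fin m → unitaryGroup (μ × γ) ℂ) : ℝ :=
  born (P.measA.effect (some x) ⊗ₖ (1 : Matrix (μ × γ) (μ × γ) ℂ))
    (finalState P.a₀ P.m₀ c₀ P.UA V)

/-- The probability that honest Bob outputs `o` against an Alice who uses a private register with
basis `γ`, initially in the state `|c₀⟩`, and applies the unitaries `W 1, …, W m` in her turns. -/
noncomputable def probBobOutputs (P : Protocol n k m α μ β) (o : BobOutcome n k)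
    {γ : Type} [Fintype γ] [DecidableEq γ] (c₀ : γ) (W : Fin m → unitaryGroup (γ × μ) ℂ) : ℝ :=
  born ((1 : Matrix γ γ ℂ) ⊗ₖ ((1 : Matrix μ μ ℂ) ⊗ₖ P.measB.effect (some o)))
    (finalState c₀ P.m₀ P.b₀ W P.UB)

/-- `B_x`: the supremum, over all strategies of Bob (any finite-dimensional private register, any
unitaries), of the probability that Alice outputs `x`. -/
noncomputable def bobForcing (P : Protocol n k m α μ β) (x : Fin n → ZMod 2) : ℝ :=
  sSup {p : ℝ | ∃ (γ : Type) (_ : Fintype γ) (_ : DecidableEq γ) (c₀ : γ)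
    (V : Fin m → unitaryGroup (μ × γ) ℂ), p = P.probAliceOutputs x c₀ V}

/-- `A_{b,x_b}`: the supremum, over all strategies of Alice (any finite-dimensional private
register, any unitaries), of the probability that Bob outputs `o = (b, x_b)`. -/
noncomputable def aliceForcing (P : Protocol n k m α μ β) (o : BobOutcome n k) : ℝ :=
  sSup {p : ℝ | ∃ (γ : Type) (_ : Fintype γ) (_ : DecidableEq γ) (c₀ : γ)
    (W : Fin m → unitaryGroup (γ × μ) ℂ), p = P.probBobOutputs o c₀ W}

/-- Alice's multiplicative bias `ε_A`, given by `A_{b,x_b} = ε_A / (C(n,k) 2ᵏ)`. -/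
noncomputable def epsA (P : Protocol n k m α μ β) (o : BobOutcome n k) : ℝ :=
  P.aliceForcing o * ((n.choose k : ℝ) * 2 ^ k)

/-- Bob's multiplicative bias `ε_B`, given by `B_x = ε_B / 2ⁿ`. -/
noncomputable def epsB (P : Protocol n k m α μ β) (x : Fin n → ZMod 2) : ℝ :=
  P.bobForcing x * 2 ^ n

/-- The forcing bias `ε = max {ε_A, ε_B}` of the protocol, where `ε_A` and `ε_B` are taken for the
outcomes that are easiest to force (finitely many outcomes, so the suprema are maxima). -/
noncomputable def forcingBias (P : Protocol n k m α μ β) : ℝ :=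
  max (⨆ o : BobOutcome n k, P.epsA o) (⨆ x : Fin n → ZMod 2, P.epsB x)

end Protocol

end ForcingOT

/-! This is Kitaev's argument, a semidefinite duality applied to both cheating players at once.
Against honest Alice, Bob never touches `𝒜`, so each of his moves preserves the marginal there.
Conversely, if he holds a purification, he can steer to every state of `𝒜 ⊗ ℳ` with that marginal
(`exists_unitary_steering`). The attainable states thus form compact convex sets, and likewise for a
cheating Alice against Bob.

Strong duality for one move (`exists_ampl_ge`, from Hahn–Banach) turns an upper bound on what can be
forced into an operator inequality `U†(Q ⊗ I)U ≤ Z ⊗ I`, where `Z` obeys the same bound one round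
earlier. Both honest players' effects are pulled back in this way through the honest run. The
expectation of `Q ⊗ I ⊗ Y` can only grow going back in time, and in the initial product state it
factors into two numbers below the two cheating bounds (`born_kronecker_finalState_le`). Letting the
slack tend to zero gives the product bound. After normalisation it reads `ε_A ε_B ≥ 2ᵏ`, so one of
the factors is at least `√2ᵏ`. -/

set_option linter.unusedSectionVars false

namespace ForcingOT

open Matrix
open scoped Kronecker ComplexOrder

/-! ### Unitary freedom of purifications -/

section Isometry

/-- Linear maps with `‖T v‖ = ‖S v‖` for all `v` differ by an isometry of the target. -/
theorem exists_linearIsometry_comp_eq {E F : Type*} [AddCommGroup E] [Module ℂ E]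
    [NormedAddCommGroup F] [InnerProductSpace ℂ F] [FiniteDimensional ℂ F]
    (T S : E →ₗ[ℂ] F) (h : ∀ v, ‖T v‖ = ‖S v‖) :
    ∃ L : F →ₗᵢ[ℂ] F, ∀ v, L (T v) = S v := by
  obtain ⟨g, hg⟩ := T.rangeRestrict.exists_rightInverse_of_surjective T.range_rangeRestrict
  have hg' : ∀ y : LinearMap.range T, T (g y) = y := fun y =>
    congrArg Subtype.val (LinearMap.congr_fun hg y)
  let L₀ : LinearMap.range T →ₗᵢ[ℂ] F :=
    { toLinearMap := S ∘ₗ g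
      norm_map' := fun y => by
        rw [LinearMap.comp_apply, ← h, hg']; rfl }
  refine ⟨L₀.extend, fun v => ?_⟩
  have h1 := L₀.extend_apply ⟨T v, LinearMap.mem_range_self T v⟩
  change L₀.extend (T v) = S (g ⟨T v, LinearMap.mem_range_self T v⟩) at h1
  -- `g (T v)` and `v` differ by an element of `ker T`, and equality of norms puts `ker T` inside
  -- `ker S`.
  rw [h1, ← sub_eq_zero, ← map_sub, ← norm_eq_zero, ← h, map_sub, hg', sub_self, norm_zero]

/-- The norms of `Xᴴ v` depend on `X` only through `X Xᴴ`, which is what the isometry lemma needs.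
-/
theorem norm_toEuclideanLin_conjTranspose_sq {η κ : Type*} [Fintype η] [DecidableEq η] [Fintype κ]
    (X : Matrix η κ ℂ) (v : EuclideanSpace ℂ η) :
    ((‖toEuclideanLin Xᴴ v‖ : ℂ)) ^ 2 = star v.ofLp ⬝ᵥ ((X * Xᴴ) *ᵥ v.ofLp) := by
  have h := inner_self_eq_norm_sq_to_K (𝕜 := ℂ) (toEuclideanLin Xᴴ v)
  refine h.symm.trans ?_
  rw [EuclideanSpace.inner_eq_star_dotProduct, dotProduct_comm]
  simp only [toLpLin_apply, star_mulVec, conjTranspose_conjTranspose, ← mulVec_mulVec,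
    dotProduct_mulVec]

/-- Unitary freedom of purifications: matrices with `X Xᴴ = Y Yᴴ` differ by a unitary. -/
theorem exists_unitary_mul_transpose_eq {η κ : Type*} [Fintype η] [DecidableEq η] [Fintype κ]
    [DecidableEq κ] (X Y : Matrix η κ ℂ) (h : X * Xᴴ = Y * Yᴴ) :
    ∃ V : unitaryGroup κ ℂ, X * (V : Matrix κ κ ℂ)ᵀ = Y := by
  obtain ⟨L, hL⟩ := exists_linearIsometry_comp_eq (toEuclideanLin Xᴴ) (toEuclideanLin Yᴴ)
    (fun v => by
      have h1 := norm_toEuclideanLin_conjTranspose_sq X v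
      rw [h, ← norm_toEuclideanLin_conjTranspose_sq Y v] at h1
      norm_cast at h1
      exact (sq_eq_sq₀ (norm_nonneg _) (norm_nonneg _)).1 h1)
  let e := L.toLinearIsometryEquiv rfl
  let b := EuclideanSpace.basisFun κ ℂ
  let W : Matrix κ κ ℂ := LinearMap.toMatrix b.toBasis b.toBasis L.toLinearMap
  have hW : W ∈ unitaryGroup κ ℂ := e.toMatrix_mem_unitaryGroup b b
  have hWL : toEuclideanLin W = L.toLinearMap := by
    rw [toEuclideanLin_eq_toLin_orthonormal]
    exact Matrix.toLin_toMatrix _ _ _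
  have hWX : W * Xᴴ = Yᴴ := by
    apply (toEuclideanLin (𝕜 := ℂ)).injective
    ext1 v
    rw [toLpLin_mul (q := 2), hWL]
    exact hL v
  -- Taking adjoints in `W Xᴴ = Yᴴ` gives `X Wᴴ = Y`, and `Wᴴ` is the transpose of the entrywise
  -- conjugate of `W`.
  refine ⟨⟨W.map star, map_star_mem_unitaryGroup_iff.2 hW⟩, ?_⟩
  rw [show (W.map star)ᵀ = Wᴴ from rfl, ← conjTranspose_conjTranspose Y, ← hWX,
    conjTranspose_mul, conjTranspose_conjTranspose]

end Isometry

/-! ### Density matrices: convexity, compactness, testing positivity -/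

section Density

variable {ι : Type*} [Fintype ι]

theorem _root_.Matrix.PosSemidef.exists_eq_mul_conjTranspose [DecidableEq ι] {σ : Matrix ι ι ℂ}
    (h : σ.PosSemidef) : ∃ Y : Matrix ι ι ℂ, σ = Y * Yᴴ := by
  open scoped MatrixOrder Matrix.Norms.L2Operator in
  obtain ⟨Y, hY⟩ := CStarAlgebra.nonneg_iff_eq_mul_star_self.1 h.nonneg
  exact ⟨Y, hY⟩

/-- Density matrices. -/
def density (ι : Type*) [Fintype ι] : Set (Matrix ι ι ℂ) := {σ | σ.PosSemidef ∧ σ.trace = 1}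

theorem convex_density : Convex ℝ (density ι) := by
  intro σ hσ τ hτ a b ha hb hab
  refine ⟨(hσ.1.smul ha).add (hτ.1.smul hb), ?_⟩
  rw [trace_add, trace_smul, trace_smul, hσ.2, hτ.2]
  rw [← add_smul, hab, one_smul]

-- The set is the continuous image under `X ↦ X Xᴴ` of the Frobenius unit sphere, which is closed
-- and bounded.
open scoped Matrix.Norms.Elementwise in
theorem isCompact_density [DecidableEq ι] : IsCompact (density ι) := by
  have h1 : IsCompact {X : Matrix ι ι ℂ | (X * Xᴴ).trace = 1} := by
    apply Metric.isCompact_of_isClosed_isBounded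
    · exact isClosed_eq (by fun_prop) continuous_const
    · refine (isBounded_iff_forall_norm_le (E := Matrix ι ι ℂ)).2 ⟨1, fun X hX => ?_⟩
      rw [Matrix.norm_le_iff zero_le_one]
      intro i j
      have h2 : ∑ i, ∑ j, ‖X i j‖ ^ 2 = 1 := by
        have h3 : (X * Xᴴ).trace = ((∑ i, ∑ j, ‖X i j‖ ^ 2 : ℝ) : ℂ) := by
          simp [trace, mul_apply, Complex.mul_conj']
        rw [Set.mem_ofPred_eq, h3] at hX
        exact_mod_cast hX
      have h4 : ‖X i j‖ ^ 2 ≤ 1 := by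
        rw [← h2]
        refine le_trans ?_ (Finset.single_le_sum (f := fun i => ∑ j, ‖X i j‖ ^ 2)
          (fun i _ => Finset.sum_nonneg fun j _ => sq_nonneg _) (Finset.mem_univ i))
        exact Finset.single_le_sum (f := fun j => ‖X i j‖ ^ 2)
          (fun j _ => sq_nonneg _) (Finset.mem_univ j)
      nlinarith [norm_nonneg (X i j)]
  have h2 : density ι = (fun X : Matrix ι ι ℂ => X * Xᴴ) '' {X | (X * Xᴴ).trace = 1} := by
    ext σ
    constructor
    · rintro ⟨h, ht⟩
      obtain ⟨Y, rfl⟩ := h.exists_eq_mul_conjTranspose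
      exact ⟨Y, ht, rfl⟩
    · rintro ⟨X, hX, rfl⟩
      exact ⟨posSemidef_self_mul_conjTranspose X, hX⟩
  rw [h2]
  exact h1.image (by fun_prop)

theorem single_mem_density [DecidableEq ι] (i : ι) : single i i (1 : ℂ) ∈ density ι := by
  refine ⟨?_, by simp⟩
  rw [← diagonal_single]
  exact PosSemidef.diagonal (Pi.single_nonneg.2 zero_le_one)

/-- `Tr(A v v†)` is the quadratic form of `A` at `v`. -/
theorem trace_mul_vecMulVec_star (A : Matrix ι ι ℂ) (v : ι → ℂ) :
    (A * vecMulVec v (star v)).trace = star v ⬝ᵥ (A *ᵥ v) := by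
  rw [mul_vecMulVec, trace_vecMulVec, dotProduct_comm]

/-- Normalised rank-one states already recover the quadratic form up to a positive factor. -/
theorem posSemidef_of_trace_nonneg {A : Matrix ι ι ℂ} (hA : A.IsHermitian)
    (h : ∀ σ ∈ density ι, 0 ≤ (A * σ).trace.re) : A.PosSemidef := by
  refine PosSemidef.of_dotProduct_mulVec_nonneg hA fun v => ?_
  have him : (star v ⬝ᵥ (A *ᵥ v)).im = 0 := by
    have := hA.im_star_dotProduct_mulVec_self v
    simpa using this
  rw [Complex.nonneg_iff]
  refine ⟨?_, him.symm⟩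
  by_cases hv : v = 0
  · simp [hv]
  have hpos : 0 < star v ⬝ᵥ v := dotProduct_star_self_pos_iff.2 hv
  obtain ⟨r, hr, hrv⟩ : ∃ r : ℝ, 0 < r ∧ star v ⬝ᵥ v = r :=
    ⟨(star v ⬝ᵥ v).re, (Complex.pos_iff.1 hpos).1,
      Complex.ext rfl (by simpa using (Complex.pos_iff.1 hpos).2.symm)⟩
  have hd : (r⁻¹ : ℝ) • vecMulVec v (star v) ∈ density ι := by
    refine ⟨(posSemidef_vecMulVec_self_star v).smul (by positivity), ?_⟩
    rw [trace_smul, trace_vecMulVec, dotProduct_comm, hrv, Complex.real_smul]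
    norm_cast
    exact inv_mul_cancel₀ hr.ne'
  have := h _ hd
  rw [mul_smul_comm, trace_smul, trace_mul_vecMulVec_star, Complex.smul_re, smul_eq_mul] at this
  exact nonneg_of_mul_nonneg_right this (by positivity)

end Density

/-! ### Partial trace and its adjoint -/

section PartialTrace

variable {ι η μ : Type*}

/-- The partial trace over `μ`, for a register `ι ≃ η × μ`. -/
def ptrace [Fintype μ] (e : ι ≃ η × μ) : Matrix ι ι ℂ →ₗ[ℂ] Matrix η η ℂ where
  toFun σ := of fun a a' => ∑ m, σ (e.symm (a, m)) (e.symm (a', m))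
  map_add' σ τ := by ext; simp [Finset.sum_add_distrib]
  map_smul' c σ := by ext; simp [Finset.mul_sum]

/-- The operator `Z ⊗ I`, for a register `ι ≃ η × μ`. -/
def ampl [DecidableEq μ] (e : ι ≃ η × μ) (Z : Matrix η η ℂ) : Matrix ι ι ℂ :=
  (Z ⊗ₖ (1 : Matrix μ μ ℂ)).submatrix e e

theorem ptrace_apply [Fintype μ] (e : ι ≃ η × μ) (σ : Matrix ι ι ℂ) (a a' : η) :
    ptrace e σ a a' = ∑ m, σ (e.symm (a, m)) (e.symm (a', m)) := rfl

theorem trace_ptrace [Fintype ι] [Fintype η] [Fintype μ] (e : ι ≃ η × μ)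
    (σ : Matrix ι ι ℂ) : (ptrace e σ).trace = σ.trace := by
  simp only [trace, diag_apply, ptrace_apply, ← Fintype.sum_prod_type']
  exact e.symm.sum_comp fun i => σ i i

/-- Partial trace and `Z ↦ Z ⊗ I` are adjoint for the trace pairing, so constraints on marginals
have dual variables of the form `Z ⊗ I`. -/
theorem trace_ampl_mul [Fintype ι] [Fintype η] [Fintype μ] [DecidableEq μ] (e : ι ≃ η × μ)
    (Z : Matrix η η ℂ) (σ : Matrix ι ι ℂ) :
    (ampl e Z * σ).trace = (Z * ptrace e σ).trace := by
  have hs : ∀ g : ι → ℂ, ∑ i, g i = ∑ a, ∑ m, g (e.symm (a, m)) := fun g => by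
    rw [← e.symm.sum_comp, Fintype.sum_prod_type]
  simp only [trace, diag_apply, mul_apply, ampl, submatrix_apply, ptrace_apply, Finset.mul_sum, hs]
  refine Finset.sum_congr rfl fun a _ => ?_
  rw [Finset.sum_comm]
  simp [one_apply]

theorem posSemidef_ptrace [Fintype μ] (e : ι ≃ η × μ) {σ : Matrix ι ι ℂ} (h : σ.PosSemidef) :
    (ptrace e σ).PosSemidef := by
  have h1 : ptrace e σ =
      ∑ m : μ, σ.submatrix (fun a => e.symm (a, m)) (fun a => e.symm (a, m)) := by
    ext a a'
    simp [ptrace_apply, Matrix.sum_apply]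
  rw [h1]
  exact posSemidef_sum _ fun m _ => h.submatrix _

theorem ptrace_mem_density [Fintype ι] [Fintype η] [Fintype μ] (e : ι ≃ η × μ)
    {σ : Matrix ι ι ℂ} (h : σ ∈ density ι) :
    ptrace e σ ∈ density η :=
  ⟨posSemidef_ptrace e h.1, (trace_ptrace e σ).trans h.2⟩

theorem continuous_ptrace [Fintype ι] [Fintype μ] (e : ι ≃ η × μ) : Continuous (ptrace e) :=
  LinearMap.continuous_of_finiteDimensional _

/-- The product of `τ` with the pure state at `m₀` is an extension. -/
theorem exists_density_ptrace_eq [Fintype ι] [Fintype η] [Fintype μ] [DecidableEq μ] (m₀ : μ)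
    (e : ι ≃ η × μ) {τ : Matrix η η ℂ}
    (h : τ ∈ density η) : ∃ σ ∈ density ι, ptrace e σ = τ := by
  have hs := single_mem_density m₀
  have hp : ptrace e ((τ ⊗ₖ single m₀ m₀ (1 : ℂ)).submatrix e e) = τ := by
    ext a a'
    simp [ptrace_apply, single_apply]
  refine ⟨(τ ⊗ₖ single m₀ m₀ (1 : ℂ)).submatrix e e,
    ⟨(h.1.kronecker hs.1).submatrix _, ?_⟩, hp⟩
  rw [← trace_ptrace e, hp, h.2]

theorem posSemidef_ampl [Finite η] [Finite μ] [DecidableEq μ] (e : ι ≃ η × μ)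
    {Z : Matrix η η ℂ} (h : Z.PosSemidef) :
    (ampl e Z).PosSemidef :=
  (h.kronecker PosSemidef.one).submatrix _

theorem isHermitian_ampl [DecidableEq μ] (e : ι ≃ η × μ) {Z : Matrix η η ℂ} (h : Z.IsHermitian) :
    (ampl e Z).IsHermitian := by
  refine IsHermitian.submatrix ?_ _
  rw [IsHermitian, conjTranspose_kronecker, h.eq, conjTranspose_one]

/-- `Z` is the diagonal block of `Z ⊗ I` at `m₀`. -/
theorem posSemidef_of_ampl [DecidableEq μ] (m₀ : μ) (e : ι ≃ η × μ) {Z : Matrix η η ℂ}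
    (h : (ampl e Z).PosSemidef) : Z.PosSemidef := by
  have h1 : Z = (ampl e Z).submatrix (fun a => e.symm (a, m₀)) (fun a => e.symm (a, m₀)) := by
    ext; simp [ampl]
  rw [h1]
  exact h.submatrix _

end PartialTrace

/-! ### Strong duality for a single move -/

section Duality

/-- A linear functional on matrices is, on Hermitian matrices, the trace against a Hermitian
matrix. -/
theorem exists_isHermitian_re_eq_trace {η : Type*} [Fintype η] [DecidableEq η]
    (f : Matrix η η ℂ →ₗ[ℂ] ℂ) :
    ∃ Z : Matrix η η ℂ, Z.IsHermitian ∧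
      ∀ τ : Matrix η η ℂ, τ.IsHermitian → (f τ).re = (Z * τ).trace.re := by
  let G : Matrix η η ℂ := of fun i j => f (single j i 1)
  have hG : ∀ τ, f τ = (G * τ).trace := by
    intro τ
    conv_lhs => rw [matrix_eq_sum_single τ]
    simp only [map_sum, trace, diag_apply, mul_apply, G, of_apply]
    rw [Finset.sum_comm]
    refine Finset.sum_congr rfl fun i _ => Finset.sum_congr rfl fun j _ => ?_
    have : single j i (τ j i) = τ j i • single j i (1 : ℂ) := by simp
    rw [this, map_smul, smul_eq_mul, mul_comm]
  -- Against Hermitian `τ`, the real part only sees the Hermitian part of `G`.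
  refine ⟨(2⁻¹ : ℝ) • (G + Gᴴ), ?_, fun τ hτ => ?_⟩
  · simp [IsHermitian, conjTranspose_smul, add_comm]
  · have h1 : (Gᴴ * τ).trace = star (G * τ).trace := by
      rw [← trace_conjTranspose, conjTranspose_mul, hτ.eq, trace_mul_comm]
    rw [hG, smul_mul_assoc, trace_smul, add_mul, trace_add, h1]
    simp
    ring

variable {ι η μ : Type*} [Fintype ι] [DecidableEq ι] [Fintype η] [DecidableEq η] [Fintype μ]
  [DecidableEq μ]

open scoped Matrix.Norms.Elementwise in
/-- Strong duality for one move of a cheating player who controls the register `μ`: if no state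
with marginal in `R` gives `K` an expectation of `t`, some `Z ⊗ I ≥ K` has expectation below `t`
on all of `R`. -/
theorem exists_ampl_ge (m₀ : μ) (e : ι ≃ η × μ) {R : Set (Matrix η η ℂ)} (hRc : IsCompact R)
    (hRv : Convex ℝ R) (hRn : R.Nonempty) (hRd : R ⊆ density η) {K : Matrix ι ι ℂ}
    (hK : K.IsHermitian) {t : ℝ}
    (h : ∀ σ ∈ density ι, ptrace e σ ∈ R → (K * σ).trace.re < t) :
    ∃ Z : Matrix η η ℂ, (ampl e Z - K).PosSemidef ∧ ∀ τ ∈ R, (Z * τ).trace.re < t := by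
  let T : Matrix ι ι ℂ →ₗ[ℂ] Matrix η η ℂ × ℂ :=
    (ptrace e).prod ((traceLinearMap ι ℂ ℂ) ∘ₗ LinearMap.mulLeft ℂ K)
  have hT : Continuous T := LinearMap.continuous_of_finiteDimensional _
  have hTσ : ∀ σ, T σ = (ptrace e σ, (K * σ).trace) := fun _ => rfl
  have : LocallyConvexSpace ℝ (Matrix η η ℂ) := NormedSpace.toLocallyConvexSpace
  -- Separate the attainable pairs (marginal, expectation of `K`) from the pairs with marginal in
  -- `R` and expectation exactly `t`; they are disjoint by `h`.
  obtain ⟨f, u, v, hu, huv, hv⟩ := RCLike.geometric_hahn_banach_compact_closed (𝕜 := ℂ)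
    (s := T '' density ι) (t := R ×ˢ {(t : ℂ)})
    (convex_density.linear_image (T.restrictScalars ℝ)) (isCompact_density.image hT)
    (hRv.prod (convex_singleton _)) (hRc.prod isCompact_singleton).isClosed
    (by
      rw [Set.disjoint_left]
      rintro _ ⟨σ, hσ, rfl⟩ ⟨h1, h2⟩
      have h3 := h σ hσ h1
      rw [show (K * σ).trace = t from h2] at h3
      simp at h3)
  obtain ⟨Y, hY, hYf⟩ := exists_isHermitian_re_eq_trace
    (f.toLinearMap ∘ₗ LinearMap.inl ℂ (Matrix η η ℂ) ℂ)
  obtain ⟨c, hc⟩ : ∃ c : ℝ, ∀ r : ℝ, (f (0, (r : ℂ))).re = c * r := by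
    refine ⟨(f (0, 1)).re, fun r => ?_⟩
    have : ((0 : Matrix η η ℂ), (r : ℂ)) = (r : ℂ) • ((0 : Matrix η η ℂ), (1 : ℂ)) := by simp
    rw [this, map_smul]
    simp [mul_comm]
  have hf : ∀ (τ : Matrix η η ℂ) (r : ℝ), τ.IsHermitian →
      (f (τ, (r : ℂ))).re = (Y * τ).trace.re + c * r := by
    intro τ r hτ
    rw [← hYf τ hτ, ← hc, ← Complex.add_re]
    simp [← map_add]
  have hKσ : ∀ σ : Matrix ι ι ℂ, σ.IsHermitian → (K * σ).trace = ((K * σ).trace.re : ℂ) := by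
    intro σ hσ
    rw [eq_comm, ← Complex.conj_eq_iff_re]
    change star (K * σ).trace = _
    rw [← trace_conjTranspose, conjTranspose_mul, hσ.eq, hK.eq, trace_mul_comm]
  have hu' : ∀ σ ∈ density ι, (Y * ptrace e σ).trace.re + c * (K * σ).trace.re < u := by
    intro σ hσ
    have := hu _ ⟨σ, hσ, rfl⟩
    rw [hTσ, hKσ σ hσ.1.1] at this
    rw [← hf _ _ (posSemidef_ptrace e hσ.1).1]
    exact this
  have hv' : ∀ τ ∈ R, v < (Y * τ).trace.re + c * t := by
    intro τ hτ
    rw [← hf _ _ (hRd hτ).1.1]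
    exact hv (τ, (t : ℂ)) ⟨hτ, rfl⟩
  -- Compare both sides of the separation at a common marginal in `R`: the `Y` terms cancel, leaving
  -- `c · Tr(Kσ) < c · t` with `Tr(Kσ) < t`. The separating functional is therefore not vertical.
  have hcpos : 0 < c := by
    obtain ⟨τ, hτ⟩ := hRn
    obtain ⟨σ, hσ, rfl⟩ := exists_density_ptrace_eq m₀ e (hRd hτ)
    have h1 := hu' σ hσ
    have h2 := hv' _ hτ
    have h3 := h σ hσ hτ
    nlinarith
  -- Solving the separation inequality for the expectation of `K`; the constant `u` becomes `u • 1`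
  -- because densities have trace one.
  let Z : Matrix η η ℂ := (c⁻¹ : ℝ) • ((u : ℝ) • (1 : Matrix η η ℂ) - Y)
  have hZ : Z.IsHermitian := by
    simp [Z, IsHermitian, conjTranspose_smul, hY.eq]
  have hZτ : ∀ τ ∈ density η, (Z * τ).trace.re = c⁻¹ * (u - (Y * τ).trace.re) := by
    intro τ hτ
    simp [Z, sub_mul, trace_sub, trace_smul, hτ.2]
  refine ⟨Z, posSemidef_of_trace_nonneg ((isHermitian_ampl e hZ).sub hK) fun σ hσ => ?_,
    fun τ hτ => ?_⟩
  · rw [sub_mul, trace_sub, trace_ampl_mul, Complex.sub_re, hZτ _ (ptrace_mem_density e hσ),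
      sub_nonneg, ← div_eq_inv_mul, le_div_iff₀ hcpos]
    linarith [hu' σ hσ]
  · rw [hZτ _ (hRd hτ), ← div_eq_inv_mul, div_lt_iff₀ hcpos]
    linarith [hv' τ hτ]

end Duality

/-! ### Sets of states, evolution, and steering -/

section StateSets

variable {ι η μ : Type*} [Fintype ι] [DecidableEq ι] [Fintype η] [DecidableEq η] [Fintype μ]
  [DecidableEq μ]

/-- A nonempty compact convex set of density matrices. -/
structure IsStateSet {ι : Type*} [Fintype ι] (S : Set (Matrix ι ι ℂ)) : Prop where
  isCompact : IsCompact S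
  convex : Convex ℝ S
  nonempty : S.Nonempty
  subset : S ⊆ density ι

/-- The states with marginal in `R`. -/
def extensions (e : ι ≃ η × μ) (R : Set (Matrix η η ℂ)) : Set (Matrix ι ι ℂ) :=
  {σ ∈ density ι | ptrace e σ ∈ R}

/-- The marginal on `η` of `U σ U†`. -/
def evolve (e : ι ≃ η × μ) (U : Matrix ι ι ℂ) : Matrix ι ι ℂ →ₗ[ℂ] Matrix η η ℂ :=
  ptrace e ∘ₗ LinearMap.mulRight ℂ Uᴴ ∘ₗ LinearMap.mulLeft ℂ U

theorem evolve_apply (e : ι ≃ η × μ) (U σ : Matrix ι ι ℂ) :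
    evolve e U σ = ptrace e (U * σ * Uᴴ) := rfl

theorem isStateSet_singleton {σ : Matrix ι ι ℂ} (h : σ ∈ density ι) :
    IsStateSet ({σ} : Set (Matrix ι ι ℂ)) :=
  ⟨isCompact_singleton, convex_singleton _, Set.singleton_nonempty _,
    Set.singleton_subset_iff.2 h⟩

theorem IsStateSet.extensions (m₀ : μ) (e : ι ≃ η × μ) {R : Set (Matrix η η ℂ)}
    (h : IsStateSet R) : IsStateSet (extensions e R) where
  isCompact := isCompact_density.inter_right (h.isCompact.isClosed.preimage (continuous_ptrace e))
  convex := convex_density.inter (h.convex.linear_preimage ((ptrace e).restrictScalars ℝ))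
  nonempty := by
    obtain ⟨τ, hτ⟩ := h.nonempty
    obtain ⟨σ, hσ, rfl⟩ := exists_density_ptrace_eq m₀ e (h.subset hτ)
    exact ⟨σ, hσ, hτ⟩
  subset := fun _ hσ => hσ.1

theorem unitary_conj_mem_density (U : unitaryGroup ι ℂ) {σ : Matrix ι ι ℂ} (h : σ ∈ density ι) :
    (U : Matrix ι ι ℂ) * σ * (U : Matrix ι ι ℂ)ᴴ ∈ density ι := by
  refine ⟨h.1.mul_mul_conjTranspose_same _, ?_⟩
  have hU : (U : Matrix ι ι ℂ)ᴴ * (U : Matrix ι ι ℂ) = 1 := mem_unitaryGroup_iff'.1 U.2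
  rw [trace_mul_comm, ← mul_assoc, hU, one_mul, h.2]

theorem IsStateSet.image_evolve (e : ι ≃ η × μ) (U : unitaryGroup ι ℂ)
    {S : Set (Matrix ι ι ℂ)} (h : IsStateSet S) :
    IsStateSet (evolve e (U : Matrix ι ι ℂ) '' S) where
  isCompact := h.isCompact.image (LinearMap.continuous_of_finiteDimensional _)
  convex := h.convex.linear_image ((evolve e (U : Matrix ι ι ℂ)).restrictScalars ℝ)
  nonempty := h.nonempty.image _
  subset := by
    rintro _ ⟨σ, hσ, rfl⟩
    exact ptrace_mem_density e (unitary_conj_mem_density U (h.subset hσ))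

theorem trace_mul_evolve (e : ι ≃ η × μ) (U σ : Matrix ι ι ℂ) (Q : Matrix η η ℂ) :
    (Q * evolve e U σ).trace = (Uᴴ * ampl e Q * U * σ).trace := by
  rw [evolve_apply, ← trace_ampl_mul, ← mul_assoc, trace_mul_comm]
  simp only [mul_assoc]

/-- A Heisenberg-picture step of the dual program. -/
theorem exists_dual_step (m₀ : μ) (e : ι ≃ η × μ) (U : unitaryGroup ι ℂ) {R : Set (Matrix η η ℂ)}
    (hR : IsStateSet R) {Q : Matrix η η ℂ} (hQ : Q.PosSemidef) {t : ℝ}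
    (h : ∀ τ ∈ evolve e (U : Matrix ι ι ℂ) '' extensions e R, (Q * τ).trace.re < t) :
    ∃ Z : Matrix η η ℂ, Z.PosSemidef ∧
      (ampl e Z - (U : Matrix ι ι ℂ)ᴴ * ampl e Q * U).PosSemidef ∧
      ∀ τ ∈ R, (Z * τ).trace.re < t := by
  have hK := (posSemidef_ampl e hQ).conjTranspose_mul_mul_same (U : Matrix ι ι ℂ)
  obtain ⟨Z, hZ, hZR⟩ := exists_ampl_ge m₀ e hR.isCompact hR.convex hR.nonempty hR.subset hK.1
    (t := t) (fun σ hσ hσR => by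
      rw [← trace_mul_evolve]
      exact h _ ⟨σ, ⟨hσ, hσR⟩, rfl⟩)
  refine ⟨Z, posSemidef_of_ampl m₀ e ?_, hZ, hZR⟩
  -- `Z ⊗ I` dominates the positive operator `U†(Q ⊗ I)U`, hence is itself positive.
  simpa using hZ.add hK

/-- A cheating player holding a purification can steer to any state with the same marginal. -/
theorem exists_unitary_steering (e : ι ≃ η × μ) {κ : Type*} [Fintype κ] [DecidableEq κ]
    (f : κ ≃ μ × ι) (Y : Matrix ι ι ℂ) {σ : Matrix ι ι ℂ} (hσ : σ.PosSemidef)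
    (h : ptrace e (Y * Yᴴ) = ptrace e σ) :
    ∃ (V : unitaryGroup κ ℂ) (Y' : Matrix ι ι ℂ), σ = Y' * Y'ᴴ ∧ ∀ a l,
      Y' (e.symm (a, (f l).1)) (f l).2 =
        ∑ l', (V : Matrix κ κ ℂ) l l' * Y (e.symm (a, (f l').1)) (f l').2 := by
  obtain ⟨Y', rfl⟩ := hσ.exists_eq_mul_conjTranspose
  -- Regroup the purification so that the columns comprise everything the cheater holds: the message
  -- and the purifying register. Then `X Xᴴ` is the marginal on `η`.
  let X : Matrix ι ι ℂ → Matrix η κ ℂ := fun Y => of fun a l => Y (e.symm (a, (f l).1)) (f l).2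
  have hX : ∀ Y, X Y * (X Y)ᴴ = ptrace e (Y * Yᴴ) := by
    intro Y
    ext a a'
    simp only [X, mul_apply, conjTranspose_apply, ptrace_apply, of_apply]
    rw [f.sum_comp fun p => Y (e.symm (a, p.1)) p.2 * star (Y (e.symm (a', p.1)) p.2),
      Fintype.sum_prod_type]
  obtain ⟨V, hV⟩ := exists_unitary_mul_transpose_eq (X Y) (X Y') (by rw [hX, hX, h])
  refine ⟨V, Y', rfl, fun a l => ?_⟩
  have h1 := congrFun (congrFun hV a) l
  simp only [X, mul_apply, transpose_apply, of_apply] at h1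
  rw [← h1]
  exact Finset.sum_congr rfl fun _ _ => mul_comm _ _

end StateSets

/-! ### Joint states as coefficient matrices -/

section Registers

variable {α μ β : Type} [Fintype α] [DecidableEq α] [Fintype μ] [DecidableEq μ]
  [Fintype β] [DecidableEq β]

theorem onRight_mulVec_apply (V : Matrix (μ × β) (μ × β) ℂ) (ψ : α × μ × β → ℂ) (a : α)
    (l : μ × β) : (onRight α V *ᵥ ψ) (a, l) = ∑ l', V l l' * ψ (a, l') := by
  simp [onRight, mulVec, dotProduct, Fintype.sum_prod_type, one_apply, Finset.sum_ite_eq]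

theorem onLeft_mulVec_apply (U : Matrix (α × μ) (α × μ) ℂ) (ψ : α × μ × β → ℂ) (a : α) (m : μ)
    (b : β) : (onLeft β U *ᵥ ψ) (a, m, b) = ∑ l' : α × μ, U (a, m) l' * ψ (l'.1, l'.2, b) := by
  simp [onLeft, mulVec, dotProduct, Fintype.sum_prod_type, one_apply]

theorem finalState_succ {m : ℕ} (a₀ : α) (m₀ : μ) (b₀ : β)
    (U : Fin (m + 1) → unitaryGroup (α × μ) ℂ) (V : Fin (m + 1) → unitaryGroup (μ × β) ℂ) :
    finalState a₀ m₀ b₀ U V =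
      onRight α (V (Fin.last m) : Matrix (μ × β) (μ × β) ℂ) *ᵥ
        (onLeft β (U (Fin.last m) : Matrix (α × μ) (α × μ) ℂ) *ᵥ
          finalState a₀ m₀ b₀ (fun j => U j.castSucc) (fun j => V j.castSucc)) := by
  rw [finalState, Fin.foldl_succ_last]
  rfl

/-- The coefficients of `ψ`, with the left two registers as rows. -/
def leftCoeff (ψ : α × μ × β → ℂ) : Matrix (α × μ) β ℂ := of fun i b => ψ (i.1, i.2, b)

/-- The coefficients of `ψ`, with the right two registers as rows. -/
def rightCoeff (ψ : α × μ × β → ℂ) : Matrix (μ × β) α ℂ := of fun i a => ψ (a, i)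

theorem leftCoeff_onLeft (U : Matrix (α × μ) (α × μ) ℂ) (ψ : α × μ × β → ℂ) :
    leftCoeff (onLeft β U *ᵥ ψ) = U * leftCoeff ψ := by
  ext ⟨a, m⟩ b
  simp only [leftCoeff, of_apply, onLeft_mulVec_apply, mul_apply]

theorem rightCoeff_onRight (V : Matrix (μ × β) (μ × β) ℂ) (ψ : α × μ × β → ℂ) :
    rightCoeff (onRight α V *ᵥ ψ) = V * rightCoeff ψ := by
  ext i a
  simp only [rightCoeff, of_apply, onRight_mulVec_apply, mul_apply]

theorem leftCoeff_initial (a₀ : α) (m₀ : μ) (b₀ : β) :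
    leftCoeff (Pi.single (a₀, m₀, b₀) (1 : ℂ)) * (leftCoeff (Pi.single (a₀, m₀, b₀) (1 : ℂ)))ᴴ =
      single (a₀, m₀) (a₀, m₀) 1 := by
  have h : leftCoeff (Pi.single (a₀, m₀, b₀) (1 : ℂ)) = single (a₀, m₀) b₀ 1 := by
    ext ⟨a, m⟩ b
    simp [leftCoeff, Pi.single_apply, single_apply, eq_comm, and_assoc]
  rw [h]
  simp

theorem rightCoeff_initial (a₀ : α) (m₀ : μ) (b₀ : β) :
    rightCoeff (Pi.single (a₀, m₀, b₀) (1 : ℂ)) *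
      (rightCoeff (Pi.single (a₀, m₀, b₀) (1 : ℂ)))ᴴ = single (m₀, b₀) (m₀, b₀) 1 := by
  have h : rightCoeff (Pi.single (a₀, m₀, b₀) (1 : ℂ)) = single (m₀, b₀) a₀ 1 := by
    ext ⟨m, b⟩ a
    simp only [rightCoeff, of_apply, Pi.single_apply, single_apply, Prod.mk.injEq]
    exact if_congr (by tauto) rfl rfl
  rw [h]
  simp

theorem dotProduct_eq_trace_leftCoeff (ψ φ : α × μ × β → ℂ) :
    star ψ ⬝ᵥ φ = (leftCoeff φ * (leftCoeff ψ)ᴴ).trace := by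
  simp [dotProduct, trace, mul_apply, leftCoeff, Fintype.sum_prod_type, mul_comm]

theorem dotProduct_eq_trace_rightCoeff (ψ φ : α × μ × β → ℂ) :
    star ψ ⬝ᵥ φ = (rightCoeff φ * (rightCoeff ψ)ᴴ).trace := by
  rw [trace_mul_comm]
  simp [dotProduct, trace, mul_apply, rightCoeff, Fintype.sum_prod_type]

theorem onLeft_ampl (Q : Matrix α α ℂ) :
    onLeft β (ampl (Equiv.refl (α × μ)) Q) = Q ⊗ₖ (1 : Matrix (μ × β) (μ × β) ℂ) := by
  rw [← one_kronecker_one, ← kronecker_assoc]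
  rfl

theorem ampl_prodComm (Q : Matrix β β ℂ) :
    ampl (Equiv.prodComm μ β) Q = (1 : Matrix μ μ ℂ) ⊗ₖ Q := by
  ext ⟨m, b⟩ ⟨m', b'⟩
  simp [ampl, mul_comm]

/-- With `C = leftCoeff ψ`, the product `C Cᴴ` is the reduced state of the left two registers. -/
theorem born_onLeft (A : Matrix (α × μ) (α × μ) ℂ) (ψ : α × μ × β → ℂ) :
    born (onLeft β A) ψ = (A * (leftCoeff ψ * (leftCoeff ψ)ᴴ)).trace.re := by
  rw [born, dotProduct_eq_trace_leftCoeff, leftCoeff_onLeft, Matrix.mul_assoc]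

theorem born_onRight (A : Matrix (μ × β) (μ × β) ℂ) (ψ : α × μ × β → ℂ) :
    born (onRight α A) ψ = (A * (rightCoeff ψ * (rightCoeff ψ)ᴴ)).trace.re := by
  rw [born, dotProduct_eq_trace_rightCoeff, rightCoeff_onRight, Matrix.mul_assoc]

end Registers

/-! ### States a cheating player can prepare -/

section Reachability

variable {α μ β : Type} [Fintype α] [DecidableEq α] [Fintype μ] [DecidableEq μ]
  [Fintype β] [DecidableEq β]

/-- The states of Alice's private register and the message register that a cheating Bob can
prepare by the end of round `m`. -/
def aliceStates (a₀ : α) (m₀ : μ) :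
    (m : ℕ) → (Fin m → unitaryGroup (α × μ) ℂ) → Set (Matrix (α × μ) (α × μ) ℂ)
  | 0, _ => {single (a₀, m₀) (a₀, m₀) 1}
  | m + 1, U => extensions (Equiv.refl (α × μ))
      (evolve (Equiv.refl (α × μ)) (U (Fin.last m) : Matrix (α × μ) (α × μ) ℂ) ''
        aliceStates a₀ m₀ m fun j => U j.castSucc)

/-- The states of Bob's private register that a cheating Alice can prepare by the end of
round `m`. -/
def bobStates (b₀ : β) :
    (m : ℕ) → (Fin m → unitaryGroup (μ × β) ℂ) → Set (Matrix β β ℂ)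
  | 0, _ => {single b₀ b₀ 1}
  | m + 1, V => evolve (Equiv.prodComm μ β) (V (Fin.last m) : Matrix (μ × β) (μ × β) ℂ) ''
      extensions (Equiv.prodComm μ β) (bobStates b₀ m fun j => V j.castSucc)

theorem isStateSet_aliceStates (a₀ : α) (m₀ : μ) :
    ∀ (m : ℕ) (U : Fin m → unitaryGroup (α × μ) ℂ), IsStateSet (aliceStates a₀ m₀ m U)
  | 0, _ => isStateSet_singleton (single_mem_density _)
  | m + 1, _ => ((isStateSet_aliceStates a₀ m₀ m _).image_evolve _ _).extensions m₀ _

theorem isStateSet_bobStates (m₀ : μ) (b₀ : β) :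
    ∀ (m : ℕ) (V : Fin m → unitaryGroup (μ × β) ℂ), IsStateSet (bobStates b₀ m V)
  | 0, _ => isStateSet_singleton (single_mem_density _)
  | m + 1, _ => ((isStateSet_bobStates m₀ b₀ m _).extensions m₀ _).image_evolve _ _

/-- A private register with the basis of `𝒜 ⊗ ℳ` can purify any target state. By induction Bob
prepares the predecessor `ρ`; after Alice's unitary the current state and the target share their
marginal on `𝒜`, so he steers. -/
theorem exists_strategy_aliceStates (a₀ : α) (m₀ : μ) :
    ∀ (m : ℕ) (U : Fin m → unitaryGroup (α × μ) ℂ), ∀ σ ∈ aliceStates a₀ m₀ m U,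
      ∃ V : Fin m → unitaryGroup (μ × (α × μ)) ℂ,
        leftCoeff (finalState a₀ m₀ (a₀, m₀) U V) *
          (leftCoeff (finalState a₀ m₀ (a₀, m₀) U V))ᴴ = σ
  | 0, _, σ, hσ => by
    refine ⟨Fin.elim0, ?_⟩
    rw [show σ = _ from hσ, ← leftCoeff_initial a₀ m₀ (a₀, m₀)]
    simp [finalState]
  | m + 1, U, σ, hσ => by
    obtain ⟨hσd, ρ, hρ, hρσ⟩ := hσ
    obtain ⟨V, hV⟩ := exists_strategy_aliceStates a₀ m₀ m _ ρ hρ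
    let φ := onLeft (α × μ) (U (Fin.last m) : Matrix (α × μ) (α × μ) ℂ) *ᵥ
      finalState a₀ m₀ (a₀, m₀) (fun j => U j.castSucc) V
    obtain ⟨W, Y, hY, hYW⟩ := exists_unitary_steering (Equiv.refl (α × μ))
      (Equiv.refl (μ × (α × μ))) (leftCoeff φ) hσd.1 (by
        rw [← hρσ, evolve_apply, ← hV, leftCoeff_onLeft, conjTranspose_mul]
        simp only [mul_assoc])
    refine ⟨Fin.snoc (α := fun _ => unitaryGroup (μ × (α × μ)) ℂ) V W, ?_⟩
    have hf : leftCoeff (finalState a₀ m₀ (a₀, m₀) U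
        (Fin.snoc (α := fun _ => unitaryGroup (μ × (α × μ)) ℂ) V W)) = Y := by
      rw [finalState_succ]
      simp only [Fin.snoc_last, Fin.snoc_castSucc]
      ext ⟨a, m⟩ c
      exact (onRight_mulVec_apply _ φ a (m, c)).trans (hYW a (m, c)).symm
    rw [hf, hY]

/-- The same induction with the order of moves reversed: Alice steers first, then Bob's unitary
acts. -/
theorem exists_strategy_bobStates (m₀ : μ) (b₀ : β) :
    ∀ (m : ℕ) (V : Fin m → unitaryGroup (μ × β) ℂ), ∀ τ ∈ bobStates b₀ m V,
      ∃ W : Fin m → unitaryGroup ((μ × β) × μ) ℂ,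
        ptrace (Equiv.prodComm μ β) (rightCoeff (finalState (m₀, b₀) m₀ b₀ W V) *
          (rightCoeff (finalState (m₀, b₀) m₀ b₀ W V))ᴴ) = τ
  | 0, _, τ, hτ => by
    refine ⟨Fin.elim0, ?_⟩
    have h := rightCoeff_initial (m₀, b₀) m₀ b₀
    rw [show τ = _ from hτ]
    simp only [finalState, Fin.foldl_zero, h]
    ext b b'
    simp [ptrace_apply, single_apply, ite_and]
  | m + 1, V, τ, hτ => by
    obtain ⟨σ, ⟨hσd, hσ⟩, hστ⟩ := hτ
    obtain ⟨W, hW⟩ := exists_strategy_bobStates m₀ b₀ m _ _ hσ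
    let φ := finalState (m₀, b₀) m₀ b₀ W fun j => V j.castSucc
    obtain ⟨W', Y, hY, hYW⟩ := exists_unitary_steering (Equiv.prodComm μ β)
      (Equiv.prodComm (μ × β) μ) (rightCoeff φ) hσd.1 hW
    refine ⟨Fin.snoc (α := fun _ => unitaryGroup ((μ × β) × μ) ℂ) W W', ?_⟩
    have hf : rightCoeff (onLeft β (W' : Matrix ((μ × β) × μ) ((μ × β) × μ) ℂ) *ᵥ φ) = Y := by
      ext ⟨m, b⟩ c
      exact (onLeft_mulVec_apply _ φ c m b).trans (hYW b (c, m)).symm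
    rw [finalState_succ]
    simp only [Fin.snoc_last, Fin.snoc_castSucc]
    rw [rightCoeff_onRight, hf, ← hστ, evolve_apply, hY, conjTranspose_mul]
    simp only [mul_assoc]

end Reachability

/-! ### Monotonicity of the Born rule -/

section Born

variable {ι : Type} [Fintype ι]

theorem born_le_born {E F : Matrix ι ι ℂ} (h : (F - E).PosSemidef) (ψ : ι → ℂ) :
    born E ψ ≤ born F ψ := by
  have h1 := (Complex.nonneg_iff.1 (h.dotProduct_mulVec_nonneg ψ)).1
  rw [sub_mulVec, dotProduct_sub, Complex.sub_re] at h1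
  exact sub_nonneg.1 h1

theorem born_nonneg {E : Matrix ι ι ℂ} (h : E.PosSemidef) (ψ : ι → ℂ) : 0 ≤ born E ψ :=
  (Complex.nonneg_iff.1 (h.dotProduct_mulVec_nonneg ψ)).1

theorem born_mulVec (E M : Matrix ι ι ℂ) (ψ : ι → ℂ) :
    born E (M *ᵥ ψ) = born (Mᴴ * E * M) ψ := by
  simp only [born, star_mulVec, ← mulVec_mulVec, ← dotProduct_mulVec]

theorem born_single [DecidableEq ι] (E : Matrix ι ι ℂ) (i : ι) :
    born E (Pi.single i 1) = (E i i).re := by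
  simp [born]

theorem posSemidef_kronecker_sub_kronecker_left {κ : Type} [Fintype κ] {Q : Matrix κ κ ℂ}
    {E F : Matrix ι ι ℂ} (hQ : Q.PosSemidef) (h : (F - E).PosSemidef) :
    (Q ⊗ₖ F - Q ⊗ₖ E).PosSemidef := by
  have h1 : Q ⊗ₖ F - Q ⊗ₖ E = Q ⊗ₖ (F - E) := by
    ext i j
    simp [mul_sub]
  rw [h1]
  exact hQ.kronecker h

theorem posSemidef_kronecker_sub_kronecker_right {κ : Type} [Fintype κ] {Q : Matrix κ κ ℂ}
    {E F : Matrix ι ι ℂ} (hQ : Q.PosSemidef) (h : (F - E).PosSemidef) :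
    (F ⊗ₖ Q - E ⊗ₖ Q).PosSemidef := by
  have h1 : F ⊗ₖ Q - E ⊗ₖ Q = (F - E) ⊗ₖ Q := by
    ext i j
    simp [sub_mul]
  rw [h1]
  exact h.kronecker hQ

end Born

/-! ### Pulling both effects back through the honest run -/

section HonestRun

variable {α μ β : Type} [Fintype α] [DecidableEq α] [Fintype μ] [DecidableEq μ]
  [Fintype β] [DecidableEq β]

theorem onLeft_mul (A B : Matrix (α × μ) (α × μ) ℂ) :
    onLeft β (A * B) = onLeft β A * onLeft β B := by
  simp only [onLeft, reindex_apply, submatrix_mul_equiv, ← mul_kronecker_mul, mul_one]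

theorem onLeft_conjTranspose (A : Matrix (α × μ) (α × μ) ℂ) :
    (onLeft β A)ᴴ = onLeft β Aᴴ := by
  simp [onLeft, conjTranspose_kronecker]

theorem onRight_conjTranspose (A : Matrix (μ × β) (μ × β) ℂ) :
    (onRight α A)ᴴ = onRight α Aᴴ := by
  simp [onRight, conjTranspose_kronecker]

theorem onLeft_conjTranspose_mul_self (U : unitaryGroup (α × μ) ℂ) :
    (onLeft β (U : Matrix (α × μ) (α × μ) ℂ))ᴴ * onLeft β (U : Matrix (α × μ) (α × μ) ℂ) = 1 := by
  have hU : (U : Matrix (α × μ) (α × μ) ℂ)ᴴ * (U : Matrix (α × μ) (α × μ) ℂ) = 1 :=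
    mem_unitaryGroup_iff'.1 U.2
  rw [onLeft_conjTranspose, ← onLeft_mul, hU]
  simp [onLeft]

theorem onRight_conjTranspose_mul_self (V : unitaryGroup (μ × β) ℂ) :
    (onRight α (V : Matrix (μ × β) (μ × β) ℂ))ᴴ * onRight α (V : Matrix (μ × β) (μ × β) ℂ) = 1 := by
  have hV : (V : Matrix (μ × β) (μ × β) ℂ)ᴴ * (V : Matrix (μ × β) (μ × β) ℂ) = 1 :=
    mem_unitaryGroup_iff'.1 V.2
  rw [onRight_conjTranspose, onRight, onRight, ← mul_kronecker_mul, hV, one_mul,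
    one_kronecker_one]

theorem born_one_finalState (a₀ : α) (m₀ : μ) (b₀ : β) :
    ∀ (m : ℕ) (U : Fin m → unitaryGroup (α × μ) ℂ) (V : Fin m → unitaryGroup (μ × β) ℂ),
      born 1 (finalState a₀ m₀ b₀ U V) = 1
  | 0, _, _ => by
    rw [finalState, Fin.foldl_zero, born_single]
    simp
  | m + 1, U, V => by
    rw [finalState_succ, born_mulVec, mul_one, onRight_conjTranspose_mul_self, born_mulVec, mul_one,
      onLeft_conjTranspose_mul_self, born_one_finalState a₀ m₀ b₀ m]

/-- The joint operator `(U† (Q ⊗ I) U) ⊗ Z`. -/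
theorem onLeft_conj_kronecker (U : Matrix (α × μ) (α × μ) ℂ) (Q : Matrix α α ℂ)
    (Z : Matrix β β ℂ) :
    (onLeft β U)ᴴ * (Q ⊗ₖ ((1 : Matrix μ μ ℂ) ⊗ₖ Z)) * onLeft β U =
      reindex (Equiv.prodAssoc α μ β) (Equiv.prodAssoc α μ β)
        ((Uᴴ * ampl (Equiv.refl (α × μ)) Q * U) ⊗ₖ Z) := by
  rw [← kronecker_assoc, onLeft_conjTranspose]
  simp only [onLeft, reindex_apply, submatrix_mul_equiv, ← mul_kronecker_mul, mul_one, one_mul]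
  rfl

theorem onRight_conj_kronecker (V : Matrix (μ × β) (μ × β) ℂ) (Q : Matrix α α ℂ)
    (Z : Matrix β β ℂ) :
    (onRight α V)ᴴ * (Q ⊗ₖ ((1 : Matrix μ μ ℂ) ⊗ₖ Z)) * onRight α V =
      Q ⊗ₖ (Vᴴ * ampl (Equiv.prodComm μ β) Z * V) := by
  rw [onRight_conjTranspose, ampl_prodComm]
  simp only [onRight, ← mul_kronecker_mul, mul_one, one_mul]

/-- Replacing Alice's last operator by a dual-feasible one on the state before her last move. -/
theorem exists_alice_dual_step (a₀ : α) (m₀ : μ) (b₀ : β) (m : ℕ)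
    (U : Fin (m + 1) → unitaryGroup (α × μ) ℂ) {Q : Matrix α α ℂ} (hQ : Q.PosSemidef) {t : ℝ}
    (h : ∀ σ ∈ aliceStates a₀ m₀ (m + 1) U, (ampl (Equiv.refl (α × μ)) Q * σ).trace.re < t) :
    ∃ Z : Matrix α α ℂ, Z.PosSemidef ∧
      (∀ σ ∈ aliceStates a₀ m₀ m (fun j => U j.castSucc),
        (ampl (Equiv.refl (α × μ)) Z * σ).trace.re < t) ∧
      ∀ (V : Fin m → unitaryGroup (μ × β) ℂ) (Y : Matrix β β ℂ), Y.PosSemidef →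
        born (Q ⊗ₖ ((1 : Matrix μ μ ℂ) ⊗ₖ Y))
            (onLeft β (U (Fin.last m) : Matrix (α × μ) (α × μ) ℂ) *ᵥ
              finalState a₀ m₀ b₀ (fun j => U j.castSucc) V) ≤
          born (Z ⊗ₖ ((1 : Matrix μ μ ℂ) ⊗ₖ Y))
            (finalState a₀ m₀ b₀ (fun j => U j.castSucc) V) := by
  set u : unitaryGroup (α × μ) ℂ := U (Fin.last m)
  have hS := isStateSet_aliceStates a₀ m₀ m fun j => U j.castSucc
  -- The expectation of `Q ⊗ I` depends only on the marginal, and every such marginal extends to a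
  -- reachable state.
  have hτ : ∀ τ ∈ evolve (Equiv.refl (α × μ)) (u : Matrix (α × μ) (α × μ) ℂ) ''
      aliceStates a₀ m₀ m (fun j => U j.castSucc), (Q * τ).trace.re < t := by
    intro τ hτ
    obtain ⟨σ, hσ, rfl⟩ := exists_density_ptrace_eq m₀ (Equiv.refl (α × μ))
      ((hS.image_evolve (Equiv.refl (α × μ)) u).subset hτ)
    rw [← trace_ampl_mul]
    exact h σ ⟨hσ, hτ⟩
  have hK := (posSemidef_ampl (Equiv.refl (α × μ)) hQ).conjTranspose_mul_mul_same
    (u : Matrix (α × μ) (α × μ) ℂ)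
  cases m with
  | zero =>
    -- Before the first round Bob has not moved and the message is fixed at `m₀`, so no duality is
    -- needed: the compression of `U†(Q ⊗ I)U` to that message has the same expectation in the
    -- initial state.
    refine ⟨_, hK.submatrix fun a => (a, m₀), fun σ hσ => ?_, fun V Y hY => ?_⟩
    · have h1 := hτ _ ⟨σ, hσ, rfl⟩
      rw [trace_mul_evolve] at h1
      rw [show σ = single (a₀, m₀) (a₀, m₀) 1 from hσ] at h1 ⊢
      simpa [ampl, trace_mul_single] using h1
    · rw [born_mulVec, onLeft_conj_kronecker, finalState, Fin.foldl_zero, born_single, born_single]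
      simp
  | succ m =>
    obtain ⟨Z, hZ, hZK, hZR⟩ := exists_dual_step m₀ (Equiv.refl (α × μ)) u
      ((isStateSet_aliceStates a₀ m₀ m fun j => U j.castSucc.castSucc).image_evolve
        (Equiv.refl (α × μ)) (U (Fin.last m).castSucc)) hQ hτ
    refine ⟨Z, hZ, fun σ hσ => ?_, fun V Y hY => ?_⟩
    · rw [trace_ampl_mul]
      exact hZR _ hσ.2
    · rw [born_mulVec, onLeft_conj_kronecker]
      refine born_le_born ?_ _
      rw [← kronecker_assoc]
      exact (posSemidef_kronecker_sub_kronecker_right hY hZK).submatrix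
        (Equiv.prodAssoc α μ β).symm

/-- Kitaev's product bound: the honest joint expectation is at most the product of any strict
upper bounds on what the two cheating players can achieve. -/
theorem born_kronecker_finalState_le (a₀ : α) (m₀ : μ) (b₀ : β) {t s : ℝ} :
    ∀ (m : ℕ) (U : Fin m → unitaryGroup (α × μ) ℂ) (V : Fin m → unitaryGroup (μ × β) ℂ)
      (Q : Matrix α α ℂ) (Y : Matrix β β ℂ), Q.PosSemidef → Y.PosSemidef →
      (∀ σ ∈ aliceStates a₀ m₀ m U, (ampl (Equiv.refl (α × μ)) Q * σ).trace.re < t) →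
      (∀ τ ∈ bobStates b₀ m V, (Y * τ).trace.re < s) →
      born (Q ⊗ₖ ((1 : Matrix μ μ ℂ) ⊗ₖ Y)) (finalState a₀ m₀ b₀ U V) ≤ t * s
  | 0, U, V, Q, Y, hQ, hY, ht, hs => by
    have hq : (Q a₀ a₀).re < t := by simpa [ampl, trace_mul_single] using ht _ rfl
    have hy : (Y b₀ b₀).re < s := by simpa [trace_mul_single] using hs _ rfl
    have hq0 := Complex.nonneg_iff.1 (hQ.diag_nonneg (i := a₀))
    have hy0 := Complex.nonneg_iff.1 (hY.diag_nonneg (i := b₀))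
    rw [finalState, Fin.foldl_zero, born_single]
    simp only [kroneckerMap_apply, one_apply_eq, one_mul, Complex.mul_re, ← hq0.2, zero_mul,
      sub_zero]
    -- The expectation in the initial product state is the product of two nonnegative diagonal
    -- entries.
    exact mul_le_mul hq.le hy.le hy0.1 (hq0.1.trans hq.le)
  | m + 1, U, V, Q, Y, hQ, hY, ht, hs => by
    obtain ⟨Z, hZ, hZs, hZle⟩ := exists_alice_dual_step a₀ m₀ b₀ m U hQ ht
    obtain ⟨X, hX, hXK, hXs⟩ := exists_dual_step m₀ (Equiv.prodComm μ β) (V (Fin.last m))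
      (isStateSet_bobStates m₀ b₀ m fun j => V j.castSucc) hY hs
    rw [finalState_succ, born_mulVec, onRight_conj_kronecker]
    -- Undo the round in reverse order: Bob's unitary first, replacing `Y` by `X`, then Alice's,
    -- replacing `Q` by `Z`.
    refine le_trans (born_le_born (F := Q ⊗ₖ ((1 : Matrix μ μ ℂ) ⊗ₖ X)) ?_ _)
      ((hZle _ X hX).trans
        (born_kronecker_finalState_le a₀ m₀ b₀ m _ _ Z X hZ hX hZs hXs))
    rw [← ampl_prodComm]
    exact posSemidef_kronecker_sub_kronecker_left hQ hXK

end HonestRun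

theorem POVM.posSemidef_one_sub {ω ι : Type} [Fintype ω] [Fintype ι] [DecidableEq ι]
    (M : POVM ω ι) (w : ω) : (1 - M.effect w).PosSemidef := by
  classical
  rw [← M.sum_eq_one, ← Finset.add_sum_erase _ _ (Finset.mem_univ w), add_sub_cancel_left]
  exact posSemidef_sum _ fun w _ => M.posSemidef w

/-! ### The product bound and the forcing bias -/

namespace Protocol

variable {n k m : ℕ} {α μ β : Type} [Fintype α] [DecidableEq α] [Fintype μ] [DecidableEq μ]
  [Fintype β] [DecidableEq β]

theorem probAliceOutputs_le_bobForcing (P : Protocol n k m α μ β) (x : Fin n → ZMod 2)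
    {γ : Type} [Fintype γ] [DecidableEq γ] (c₀ : γ) (V : Fin m → unitaryGroup (μ × γ) ℂ) :
    P.probAliceOutputs x c₀ V ≤ P.bobForcing x := by
  -- Boundedness by `1` matters, since the real `sSup` of an unbounded set defaults to `0`. It holds
  -- because effects are at most `1` and the final state is normalised.
  refine le_csSup ⟨1, ?_⟩ ⟨γ, _, _, c₀, V, rfl⟩
  rintro _ ⟨γ, _, _, c₀, V, rfl⟩
  rw [probAliceOutputs, ← born_one_finalState P.a₀ P.m₀ c₀ m P.UA V]
  refine born_le_born ?_ _
  rw [← one_kronecker_one]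
  exact posSemidef_kronecker_sub_kronecker_right PosSemidef.one
    (P.measA.posSemidef_one_sub (some x))

theorem probBobOutputs_le_aliceForcing (P : Protocol n k m α μ β) (o : BobOutcome n k)
    {γ : Type} [Fintype γ] [DecidableEq γ] (c₀ : γ) (W : Fin m → unitaryGroup (γ × μ) ℂ) :
    P.probBobOutputs o c₀ W ≤ P.aliceForcing o := by
  refine le_csSup ⟨1, ?_⟩ ⟨γ, _, _, c₀, W, rfl⟩
  rintro _ ⟨γ, _, _, c₀, W, rfl⟩
  rw [probBobOutputs, ← born_one_finalState c₀ P.m₀ P.b₀ m W P.UB]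
  refine born_le_born ?_ _
  rw [← one_kronecker_one, ← one_kronecker_one]
  exact posSemidef_kronecker_sub_kronecker_left PosSemidef.one
    (posSemidef_kronecker_sub_kronecker_left PosSemidef.one (P.measB.posSemidef_one_sub (some o)))

theorem bobForcing_nonneg (P : Protocol n k m α μ β) (x : Fin n → ZMod 2) :
    0 ≤ P.bobForcing x := by
  refine Real.sSup_nonneg ?_
  rintro _ ⟨γ, _, _, c₀, V, rfl⟩
  exact born_nonneg ((P.measA.posSemidef _).kronecker PosSemidef.one) _

/-- Duality needs strict upper bounds, so both suprema are enlarged by `ε`, which then tends to `0`.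
Steering guarantees that every state in the two sets comes from an actual strategy and so respects
these bounds. -/
theorem honestProb_le (P : Protocol n k m α μ β) (x : Fin n → ZMod 2) (o : BobOutcome n k) :
    P.honestProb x o ≤ P.bobForcing x * P.aliceForcing o := by
  have key : ∀ ε > 0, P.honestProb x o ≤ (P.bobForcing x + ε) * (P.aliceForcing o + ε) := by
    intro ε hε
    refine born_kronecker_finalState_le P.a₀ P.m₀ P.b₀ m P.UA P.UB _ _ (P.measA.posSemidef _)
      (P.measB.posSemidef _) (fun σ hσ => ?_) (fun τ hτ => ?_)
    · obtain ⟨V, rfl⟩ := exists_strategy_aliceStates P.a₀ P.m₀ m P.UA σ hσ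
      rw [← born_onLeft, onLeft_ampl]
      exact (P.probAliceOutputs_le_bobForcing x (P.a₀, P.m₀) V).trans_lt
        (lt_add_of_pos_right _ hε)
    · obtain ⟨W, rfl⟩ := exists_strategy_bobStates P.m₀ P.b₀ m P.UB τ hτ
      rw [← trace_ampl_mul, ← born_onRight, ampl_prodComm]
      exact (P.probBobOutputs_le_aliceForcing o (P.m₀, P.b₀) W).trans_lt
        (lt_add_of_pos_right _ hε)
  have hlim : Filter.Tendsto (fun ε : ℝ => (P.bobForcing x + ε) * (P.aliceForcing o + ε))
      (nhdsWithin 0 (Set.Ioi 0)) (nhds (P.bobForcing x * P.aliceForcing o)) := by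
    have hc : Continuous fun ε : ℝ => (P.bobForcing x + ε) * (P.aliceForcing o + ε) := by fun_prop
    simpa using (hc.tendsto 0).mono_left nhdsWithin_le_nhds
  exact ge_of_tendsto hlim (eventually_nhdsWithin_of_forall key)

theorem sqrt_two_pow_le_max (hkn : k ≤ n) (P : Protocol n k m α μ β) (hP : P.IsForcingOT)
    {x : Fin n → ZMod 2} {o : BobOutcome n k} (h : Consistent x o) :
    Real.sqrt 2 ^ k ≤ max (P.epsA o) (P.epsB x) := by
  have h1 := P.honestProb_le x o
  rw [hP x o h] at h1
  have hc : (0 : ℝ) < n.choose k := by exact_mod_cast Nat.choose_pos hkn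
  -- The normalisations multiply to `C(n,k) 2ᵏ · 2ⁿ`, exceeding the honest denominator by exactly
  -- `2ᵏ`.
  have h2 : (Real.sqrt 2 ^ k) * (Real.sqrt 2 ^ k) ≤ P.epsA o * P.epsB x := by
    rw [← mul_pow, Real.mul_self_sqrt zero_le_two, epsA, epsB]
    rw [div_le_iff₀ (by positivity)] at h1
    calc (2 : ℝ) ^ k = 2 ^ k * 1 := (mul_one _).symm
      _ ≤ 2 ^ k * (P.bobForcing x * P.aliceForcing o * (n.choose k * 2 ^ n)) := by gcongr
      _ = _ := by ring
  have hB : 0 ≤ P.epsB x := mul_nonneg (P.bobForcing_nonneg x) (by positivity)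
  by_contra! hlt
  have hA := (le_max_left _ _).trans_lt hlt
  have hB' := (le_max_right _ _).trans_lt hlt
  have hr : 0 < Real.sqrt 2 ^ k := by positivity
  nlinarith

theorem sqrt_two_pow_le_forcingBias (hkn : k ≤ n) (P : Protocol n k m α μ β)
    (hP : P.IsForcingOT) : Real.sqrt 2 ^ k ≤ P.forcingBias := by
  obtain ⟨b, -, hb⟩ := Finset.exists_subset_card_eq
    (s := (Finset.univ : Finset (Fin n))) (n := k) (by simpa using hkn)
  -- One consistent pair suffices: the zero string and its restriction to any `k`-subset.
  let o : BobOutcome n k := ⟨⟨b, hb⟩, fun _ => 0⟩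
  refine (P.sqrt_two_pow_le_max hkn hP (x := 0) (o := o) fun _ => rfl).trans (max_le_max ?_ ?_)
  · exact le_ciSup (Set.finite_range fun o => P.epsA o).bddAbove o
  · exact le_ciSup (Set.finite_range fun x => P.epsB x).bddAbove 0

end Protocol

end ForcingOT

theorem theorem3 {n k m : ℕ} (hkn : k ≤ n) {α μ β : Type} [Fintype α] [DecidableEq α]
    [Fintype μ] [DecidableEq μ] [Fintype β] [DecidableEq β]
    (P : ForcingOT.Protocol n k m α μ β) (hP : P.IsForcingOT) :
    (∀ (x : Fin n → ZMod 2) (o : ForcingOT.BobOutcome n k), ForcingOT.Consistent x o →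
      P.bobForcing x * P.aliceForcing o ≥ P.honestProb x o ∧
      P.honestProb x o = 1 / ((n.choose k : ℝ) * 2 ^ n) ∧
      max (P.epsA o) (P.epsB x) ≥ Real.sqrt 2 ^ k) ∧
    P.forcingBias ≥ Real.sqrt 2 ^ k :=
  ⟨fun x o h => ⟨P.honestProb_le x o, hP x o h, P.sqrt_two_pow_le_max hkn hP h⟩,
    P.sqrt_two_pow_le_forcingBias hkn hP⟩
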